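/- Let $\psi:\{1,2,3,\dots\}\to(0,\infty)$ be a positive, non-increasing sequence, and let $\theta$ be an irrational real number with principal convergents $p_k/q_k$ ($k\ge 0$), i.e. the convergents, in lowest terms with $q_k\ge 1$, of the regular continued fraction expansion of $\theta$, indexed so that $p_0/q_0=\lfloor\theta\rfloor/1$. Write $\|x\|$ for the distance from the real number $x$ to the nearest integer. Then, for Lebesgue-almost every $s\in\mathbb{R}$, \[ \|n\theta-s\|<\psi(n)\quad\text{for infinitely many positive integers } n \] if and only if \[ \sum_{k=0}^{\infty}\left(\sum_{n=q_k}^{q_{k+1}-1}\min\bigl(\psi(n),\|q_k\theta\|\bigr)\right)=\infty . \] That is: if the series diverges, then for almost every $s$ the inequality has infinitely many solutions $n$; if it converges, then for almost every $s$ it has only finitely many. -/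

import Mathlib

/-- The distance from a real number to the nearest integer. -/
noncomputable def distNearestInt (x : ℝ) : ℝ := |x - round x|

/-- The denominator `q_k` (in lowest terms) of the `k`-th principal convergent `p_k / q_k` of the
continued fraction expansion of `θ`; the index starts at `k = 0`, with `p_0 / q_0 = ⌊θ⌋ / 1`. -/
noncomputable def convergentDen (θ : ℝ) (k : ℕ) : ℕ := (θ.convergent k).den

/-! Work on the circle with `α = θ mod 1`. By best approximation, the smallest of `‖α‖, …, ‖n • α‖`
is `‖q_k • α‖` for `q_k ≤ n < q_{k+1}`. The double series is therefore the plain sum of the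
non-increasing weights `g n = min (ψ n) (returnDist α n)`, and the question is whether almost every
point lies in infinitely many arcs of radius `ψ n` about `n • α`.

Convergence: the arc at `n` is almost covered by the larger arc at `n - m`, so it adds measure at
most `2 * min (ψ n) ‖m • α‖`. Taking `m = q_k` in the `k`-th block costs about `g n`. Near the start
of a block that shift may reach back too far and `m = q_{k-1}` is used; `mul_min_le` charges this to
the two preceding blocks. Hence the union of a tail of arcs has measure tending to `0`
(`volume_arcUnion_le`, `tendsto_mul_psi`).

Divergence: shrink the arcs to radius `g n / 4`. They are quasi-independent: separation of orbit
points and a packing count bound the sum of pairwise overlaps by a constant times the square of the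
sum of measures (`sum_sum_inter_le`). Chung–Erdős then gives the limsup set positive measure, and
ergodicity of the rotation raises this to full measure. -/

open MeasureTheory Set Filter Topology

/-! ### Continued fraction convergents -/

/-- Numerator and denominator of the `n`-th convergent, by recursion on the first partial quotient. -/
noncomputable def continuantPair : ℝ → ℕ → ℤ × ℤ
  | ξ, 0 => (⌊ξ⌋, 1)
  | ξ, n + 1 =>
    (⌊ξ⌋ * (continuantPair (Int.fract ξ)⁻¹ n).1 + (continuantPair (Int.fract ξ)⁻¹ n).2,
      (continuantPair (Int.fract ξ)⁻¹ n).1)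

/-- The signed error `q_n ξ - p_n` of the `n`-th convergent. -/
noncomputable def convergentError (ξ : ℝ) (n : ℕ) : ℝ :=
  (continuantPair ξ n).2 * ξ - (continuantPair ξ n).1

theorem Irrational.fract_pos {ξ : ℝ} (h : Irrational ξ) : 0 < Int.fract ξ := by
  refine lt_of_le_of_ne (Int.fract_nonneg ξ) fun h0 => ?_
  have h1 : (⌊ξ⌋ : ℝ) = ξ := by linarith [Int.floor_add_fract ξ]
  exact h.ne_int ⌊ξ⌋ h1.symm

theorem Irrational.inv_fract {ξ : ℝ} (h : Irrational ξ) : Irrational (Int.fract ξ)⁻¹ := by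
  rw [irrational_inv_iff]
  exact h.sub_intCast ⌊ξ⌋

theorem Irrational.one_lt_inv_fract {ξ : ℝ} (h : Irrational ξ) : 1 < (Int.fract ξ)⁻¹ :=
  (one_lt_inv₀ h.fract_pos).2 (Int.fract_lt_one ξ)

theorem continuantPair_pos (n : ℕ) {ξ : ℝ} (h : Irrational ξ) :
    0 < (continuantPair ξ n).2 ∧ (1 < ξ → 0 < (continuantPair ξ n).1) := by
  induction n generalizing ξ with
  | zero =>
    refine ⟨by simp [continuantPair], fun h1 => ?_⟩
    have : (1 : ℤ) ≤ ⌊ξ⌋ := Int.le_floor.2 (by exact_mod_cast h1.le)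
    simp only [continuantPair]; omega
  | succ n ih =>
    obtain ⟨h1, h2⟩ := ih h.inv_fract
    have h3 := h2 h.one_lt_inv_fract
    refine ⟨h3, fun hξ => ?_⟩
    have : (1 : ℤ) ≤ ⌊ξ⌋ := Int.le_floor.2 (by exact_mod_cast hξ.le)
    simp only [continuantPair]
    positivity

theorem continuantPair_rec (n : ℕ) {ξ : ℝ} (h : Irrational ξ) :
    ∃ a : ℤ, 1 ≤ a ∧
      (continuantPair ξ (n + 2)).1 = a * (continuantPair ξ (n + 1)).1 + (continuantPair ξ n).1 ∧
      (continuantPair ξ (n + 2)).2 = a * (continuantPair ξ (n + 1)).2 + (continuantPair ξ n).2 := by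
  induction n generalizing ξ with
  | zero =>
    refine ⟨⌊(Int.fract (Int.fract ξ)⁻¹)⁻¹⌋, ?_, ?_, ?_⟩
    · exact Int.le_floor.2 (by exact_mod_cast h.inv_fract.one_lt_inv_fract.le)
    · simp only [continuantPair]; ring
    · simp only [continuantPair]; ring
  | succ n ih =>
    obtain ⟨a, ha, h1, h2⟩ := ih h.inv_fract
    refine ⟨a, ha, ?_, ?_⟩
    · rw [continuantPair, continuantPair.eq_2 ξ (n + 1), continuantPair.eq_2 ξ n]
      simp only [h1, h2]; ring
    · rw [continuantPair, continuantPair.eq_2 ξ (n + 1), continuantPair.eq_2 ξ n]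
      simp only [h1]

theorem continuantPair_det (n : ℕ) (ξ : ℝ) :
    (continuantPair ξ (n + 1)).1 * (continuantPair ξ n).2 -
      (continuantPair ξ n).1 * (continuantPair ξ (n + 1)).2 = (-1) ^ n := by
  induction n generalizing ξ with
  | zero => simp only [continuantPair]; ring
  | succ n ih =>
    have := ih (Int.fract ξ)⁻¹
    rw [continuantPair, continuantPair.eq_2 ξ n, pow_succ]
    linear_combination (-1 : ℤ) * this

theorem convergentError_succ (n : ℕ) {ξ : ℝ} (h : Irrational ξ) :
    convergentError ξ (n + 1) = -(Int.fract ξ * convergentError (Int.fract ξ)⁻¹ n) := by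
  have h0 := mul_inv_cancel₀ h.fract_pos.ne'
  have h1 := Int.self_sub_floor ξ
  rw [convergentError, convergentError, continuantPair]
  generalize continuantPair (Int.fract ξ)⁻¹ n = c
  push_cast
  linear_combination c.1 * h1 + c.2 * h0

theorem convergentError_sign (n : ℕ) {ξ : ℝ} (h : Irrational ξ) :
    0 < (-1) ^ n * convergentError ξ n := by
  induction n generalizing ξ with
  | zero =>
    have := h.fract_pos
    rw [← Int.self_sub_floor] at this
    rw [convergentError, continuantPair]
    push_cast
    linarith
  | succ n ih =>
    rw [convergentError_succ n h, pow_succ]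
    have := mul_pos h.fract_pos (ih h.inv_fract)
    linarith

theorem convergent_eq_continuantPair (n : ℕ) {ξ : ℝ} (h : Irrational ξ) :
    ξ.convergent n = (continuantPair ξ n).1 / (continuantPair ξ n).2 := by
  induction n generalizing ξ with
  | zero => simp [continuantPair]
  | succ n ih =>
    have h1 := (continuantPair_pos n h.inv_fract).2 h.one_lt_inv_fract
    have h2 : ((continuantPair (Int.fract ξ)⁻¹ n).1 : ℚ) ≠ 0 := by exact_mod_cast h1.ne'
    rw [Real.convergent_succ, ih h.inv_fract]
    simp only [continuantPair]
    push_cast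
    rw [inv_div, add_div, mul_div_cancel_right₀ _ h2]

theorem convergentDen_eq (n : ℕ) {ξ : ℝ} (h : Irrational ξ) :
    (convergentDen ξ n : ℤ) = (continuantPair ξ n).2 := by
  rw [convergentDen, convergent_eq_continuantPair n h]
  refine Rat.den_div_eq_of_coprime (continuantPair_pos n h).1 ?_
  rw [← Int.isCoprime_iff_nat_coprime]
  have hdet := continuantPair_det n ξ
  have hsq : ((-1 : ℤ) ^ n) * (-1) ^ n = 1 := by rw [← mul_pow]; simp
  refine ⟨-(-1) ^ n * (continuantPair ξ (n + 1)).2, (-1) ^ n * (continuantPair ξ (n + 1)).1, ?_⟩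
  linear_combination (-1 : ℤ) ^ n * hdet + hsq

/-- Convergents are best approximations of the second kind. -/
theorem abs_convergentError_le (k : ℕ) {ξ : ℝ} (h : Irrational ξ) {j p : ℤ} (hj : 0 < j)
    (hjk : j < (continuantPair ξ (k + 1)).2) : |convergentError ξ k| ≤ |j * ξ - p| := by
  set P := (continuantPair ξ k).1 with hP
  set Q := (continuantPair ξ k).2 with hQ
  set P' := (continuantPair ξ (k + 1)).1 with hP'
  set Q' := (continuantPair ξ (k + 1)).2 with hQ'
  have hdet : P' * Q - P * Q' = (-1) ^ k := continuantPair_det k ξ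
  have hsq : ((-1 : ℤ) ^ k) * (-1) ^ k = 1 := by rw [← mul_pow]; simp
  have hQpos : 0 < Q := (continuantPair_pos k h).1
  have hQpos' : 0 < Q' := (continuantPair_pos (k + 1) h).1
  -- The determinant is `±1`, so `(j, p)` is an integer combination of two consecutive convergents.
  -- The condition `0 < j < Q'` forces `x ≠ 0` and forbids `x`, `y` of equal sign. As consecutive
  -- errors alternate in sign, the two contributions to `j ξ - p` reinforce each other.
  obtain ⟨x, hx⟩ : ∃ x : ℤ, x = (-1) ^ k * (P' * j - Q' * p) := ⟨_, rfl⟩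
  obtain ⟨y, hy⟩ : ∃ y : ℤ, y = (-1) ^ k * (Q * p - P * j) := ⟨_, rfl⟩
  have hj' : j = x * Q + y * Q' := by
    rw [hx, hy]; linear_combination (-j * (-1 : ℤ) ^ k) * hdet - j * hsq
  have hp' : p = x * P + y * P' := by
    rw [hx, hy]; linear_combination (-p * (-1 : ℤ) ^ k) * hdet - p * hsq
  have hE : (j : ℝ) * ξ - p = x * convergentError ξ k + y * convergentError ξ (k + 1) := by
    simp only [convergentError, ← hP, ← hQ, ← hP', ← hQ']
    rw [hj', hp']; push_cast; ring
  have s1 := convergentError_sign k h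
  have s2 := convergentError_sign (k + 1) h
  set A := convergentError ξ k
  set B := convergentError ξ (k + 1)
  have habs : ∀ z : ℝ, |z| = |(-1) ^ k * z| := fun z => by simp [abs_mul]
  rw [hE, habs A, habs (_ + _), abs_of_pos s1]
  set a := (-1) ^ k * A with ha
  have hb : 0 < -((-1) ^ k * B) := by rw [pow_succ] at s2; linarith
  set b := -((-1) ^ k * B) with hbd
  have e : (-1) ^ k * (x * A + y * B) = x * a - y * b := by rw [ha, hbd]; ring
  rw [e]
  have hx0 : x ≠ 0 := by
    rintro rfl
    have hy1 : 1 ≤ y := by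
      by_contra hlt
      nlinarith
    nlinarith
  rcases lt_or_gt_of_ne hx0 with hneg | hpos
  · have hy1 : 0 ≤ y := by
      by_contra hlt
      nlinarith
    have h1 : (x : ℝ) ≤ -1 := by exact_mod_cast (by omega : x ≤ -1)
    have h2 : (0 : ℝ) ≤ y := by exact_mod_cast hy1
    refine le_trans ?_ (neg_le_abs _)
    nlinarith
  · have hy1 : y ≤ 0 := by
      by_contra hlt
      nlinarith
    have h1 : (1 : ℝ) ≤ x := by exact_mod_cast hpos
    have h2 : (y : ℝ) ≤ 0 := by exact_mod_cast hy1
    refine le_trans ?_ (le_abs_self _)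
    nlinarith

/-- The arithmetic properties of the denominators `q` of the convergents that govern the
orbit `n • α` of a rotation of the circle. -/
structure IsReturnSequence (α : UnitAddCircle) (q : ℕ → ℕ) : Prop where
  zero : q 0 = 1
  mono : Monotone q
  add_le : ∀ k, q k + q (k + 1) ≤ q (k + 2)
  norm_le : ∀ k j, 0 < j → j < q (k + 1) → ‖q k • α‖ ≤ ‖j • α‖
  half_le : ∀ k, 1 ≤ k → 1 / 2 ≤ q (k + 1) * ‖q k • α‖

theorem norm_nsmul_coe_eq (θ : ℝ) (n : ℕ) :
    ‖n • (θ : UnitAddCircle)‖ = distNearestInt (n * θ) := by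
  rw [← AddCircle.coe_nsmul, UnitAddCircle.norm_eq, distNearestInt, nsmul_eq_mul]

/-- Best approximation gives `norm_le`; the determinant identity, with decreasing errors, gives
`half_le`. The latter can fail at `k = 0`: when the fractional part of `θ` exceeds `1/2`, `q 0 = q 1
= 1` and `‖α‖ < 1/2`. -/
theorem isReturnSequence_convergentDen {θ : ℝ} (hθ : Irrational θ) :
    IsReturnSequence (θ : UnitAddCircle) (convergentDen θ) := by
  have hadd : ∀ k, convergentDen θ k + convergentDen θ (k + 1) ≤ convergentDen θ (k + 1 + 1) := by
    intro k
    zify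
    rw [convergentDen_eq _ hθ, convergentDen_eq _ hθ, convergentDen_eq _ hθ]
    obtain ⟨a, ha, -, h2⟩ := continuantPair_rec k hθ
    rw [h2]
    have := (continuantPair_pos (k + 1) hθ).1
    nlinarith
  have hpos : ∀ k, 0 < convergentDen θ k := fun k => Rat.den_pos _
  have h0 : convergentDen θ 0 = 1 := by simp [convergentDen]
  have hmono : Monotone (convergentDen θ) := by
    refine monotone_nat_of_le_succ fun k => ?_
    cases k with
    | zero => rw [h0]; exact hpos 1
    | succ k => have := hadd k; omega
  have hbest : ∀ k j : ℕ, 0 < j → j < convergentDen θ (k + 1) → ∀ p : ℤ,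
      |convergentError θ k| ≤ |(j : ℝ) * θ - p| := by
    intro k j hj hjk p
    have := abs_convergentError_le k hθ (j := j) (p := p) (by exact_mod_cast hj)
      (by rw [← convergentDen_eq _ hθ]; exact_mod_cast hjk)
    simpa using this
  have herr : ∀ k, convergentError θ k = (convergentDen θ k : ℝ) * θ - (continuantPair θ k).1 := by
    intro k
    rw [convergentError, ← convergentDen_eq k hθ]; simp
  refine ⟨h0, hmono, hadd, fun k j hj hjk => ?_, fun k hk => ?_⟩
  · rw [norm_nsmul_coe_eq, norm_nsmul_coe_eq]
    refine le_trans ?_ (hbest k j hj hjk (round ((j : ℝ) * θ)))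
    rw [herr]
    exact round_le _ _
  · have hlt : convergentDen θ k < convergentDen θ (k + 1) := by
      obtain ⟨l, rfl⟩ : ∃ l, k = l + 1 := ⟨k - 1, by omega⟩
      have := hadd l; have := hpos l; omega
    have h1 : |convergentError θ k| ≤ ‖convergentDen θ k • (θ : UnitAddCircle)‖ := by
      rw [norm_nsmul_coe_eq]
      exact hbest k _ (hpos k) hlt _
    have h2 : |convergentError θ (k + 1)| ≤ |convergentError θ k| := by
      rw [herr k]
      refine hbest (k + 1) _ (hpos k) ?_ _
      have := hadd k; have := hpos (k + 1); omega
    have hdet : (convergentDen θ (k + 1) : ℝ) * convergentError θ k -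
        convergentDen θ k * convergentError θ (k + 1) = (-1) ^ k := by
      have := continuantPair_det k θ
      rw [← convergentDen_eq _ hθ, ← convergentDen_eq _ hθ] at this
      rw [herr, herr]
      have h := congrArg (Int.cast : ℤ → ℝ) this
      push_cast at h
      linear_combination h
    have h3 : (1 : ℝ) ≤ convergentDen θ (k + 1) * |convergentError θ k| +
        convergentDen θ k * |convergentError θ (k + 1)| := by
      have : |(convergentDen θ (k + 1) : ℝ) * convergentError θ k -
        convergentDen θ k * convergentError θ (k + 1)| = 1 := by rw [hdet]; simp
      rw [← this]
      refine (abs_sub _ _).trans ?_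
      rw [abs_mul, abs_mul, Nat.abs_cast, Nat.abs_cast]
    have h4 : (convergentDen θ k : ℝ) ≤ convergentDen θ (k + 1) := by exact_mod_cast hlt.le
    have h5 : (0 : ℝ) ≤ convergentDen θ k := by positivity
    nlinarith [abs_nonneg (convergentError θ k), abs_nonneg (convergentError θ (k + 1))]
/-! ### The return distance and the weights of the series -/

/-- The smallest distance to `0` among the first `n` multiples of `α` (for `n ≥ 1`). -/
noncomputable def returnDist (α : UnitAddCircle) (n : ℕ) : ℝ :=
  sInf ((fun j : ℕ => ‖j • α‖) '' Icc 1 (max 1 n))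

/-- The terms of the series that decides between measure zero and full measure. -/
noncomputable def approxWeight (ψ : ℕ → ℝ) (α : UnitAddCircle) (n : ℕ) : ℝ :=
  min (ψ n) (returnDist α n)

section Weights

variable {α : UnitAddCircle} {q : ℕ → ℕ} {ψ : ℕ → ℝ}

theorem returnDist_bddBelow (α : UnitAddCircle) (s : Set ℕ) :
    BddBelow ((fun j : ℕ => ‖j • α‖) '' s) :=
  ⟨0, by rintro _ ⟨j, -, rfl⟩; exact norm_nonneg _⟩

theorem returnDist_le_norm {n j : ℕ} (hj : 0 < j) (hjn : j ≤ n) : returnDist α n ≤ ‖j • α‖ :=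
  csInf_le (returnDist_bddBelow α _) ⟨j, ⟨hj, hjn.trans (le_max_right _ _)⟩, rfl⟩

theorem le_returnDist {n : ℕ} (hn : 0 < n) {c : ℝ} (h : ∀ j, 0 < j → j ≤ n → c ≤ ‖j • α‖) :
    c ≤ returnDist α n := by
  refine le_csInf ⟨_, 1, by simp, rfl⟩ ?_
  rintro _ ⟨j, hj, rfl⟩
  have : max 1 n = n := by omega
  exact h j hj.1 (by simpa [this] using hj.2)

theorem returnDist_nonneg (α : UnitAddCircle) (n : ℕ) : 0 ≤ returnDist α n :=
  Real.sInf_nonneg (by rintro _ ⟨j, -, rfl⟩; exact norm_nonneg _)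

theorem returnDist_le_half (α : UnitAddCircle) (n : ℕ) : returnDist α n ≤ 1 / 2 := by
  refine (csInf_le (returnDist_bddBelow α _) ⟨1, by simp, rfl⟩).trans ?_
  simpa using AddCircle.norm_le_half_period (1 : ℝ) (x := (1 : ℕ) • α) one_ne_zero

theorem returnDist_antitone (α : UnitAddCircle) : Antitone (returnDist α) := fun m n hmn =>
  csInf_le_csInf (returnDist_bddBelow α _) ⟨_, 1, by simp, rfl⟩
    (image_mono (Icc_subset_Icc_right (max_le_max le_rfl hmn)))

theorem approxWeight_antitone (hψ : Antitone ψ) (α : UnitAddCircle) :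
    Antitone (approxWeight ψ α) := fun _ _ hmn =>
  min_le_min (hψ hmn) (returnDist_antitone α hmn)

theorem approxWeight_nonneg (hψ : ∀ n, 0 < ψ n) (α : UnitAddCircle) (n : ℕ) :
    0 ≤ approxWeight ψ α n :=
  le_min (hψ n).le (returnDist_nonneg α n)

namespace IsReturnSequence

variable (h : IsReturnSequence α q)
include h

theorem pos (k : ℕ) : 0 < q k := by
  have := h.mono (Nat.zero_le k)
  rw [h.zero] at this
  omega

theorem le_self (k : ℕ) : k ≤ q k := by
  induction k using Nat.twoStepInduction with
  | zero => omega
  | one => exact h.pos 1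
  | more k _ ih => have := h.add_le k; have := h.pos k; omega

theorem tendsto_atTop : Tendsto q atTop atTop :=
  tendsto_atTop_mono h.le_self tendsto_id

theorem norm_le_returnDist {k n : ℕ} (hn : 0 < n) (hnk : n < q (k + 1)) :
    ‖q k • α‖ ≤ returnDist α n :=
  le_returnDist hn fun j hj hjn => h.norm_le k j hj (hjn.trans_lt hnk)

theorem returnDist_eq {k n : ℕ} (hkn : q k ≤ n) (hnk : n < q (k + 1)) :
    returnDist α n = ‖q k • α‖ :=
  le_antisymm (returnDist_le_norm (h.pos k) hkn)
    (h.norm_le_returnDist ((h.pos k).trans_le hkn) hnk)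

/-- On the block from `q k` to `q (k + 1)` the return distance is constantly `‖q k • α‖`, and the
blocks tile the positive integers. The first block is empty if `q 0 = q 1`. -/
theorem sum_blocks (ψ : ℕ → ℝ) (K : ℕ) :
    ∑ k ∈ Finset.range K, ∑ n ∈ Finset.Ico (q k) (q (k + 1)), min (ψ n) ‖q k • α‖ =
      ∑ n ∈ Finset.Ico 1 (q K), approxWeight ψ α n := by
  induction K with
  | zero => simp [h.zero]
  | succ K ih =>
    rw [Finset.sum_range_succ, ih,
      ← Finset.sum_Ico_consecutive _ (h.pos K) (h.mono (Nat.le_succ K))]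
    congr 1
    refine Finset.sum_congr rfl fun n hn => ?_
    rw [Finset.mem_Ico] at hn
    rw [approxWeight, h.returnDist_eq hn.1 hn.2]

theorem two_mul_le (k : ℕ) : 2 * q k ≤ q (k + 2) := by
  have := h.add_le k; have := h.mono (Nat.le_succ k); simp only [Nat.succ_eq_add_one] at this
  omega

/-- The weights on two consecutive blocks dominate `q_k min(ψ(q_k), ‖q_{k-1} α‖)`. -/
theorem mul_min_le (hψ : Antitone ψ) (hpos : ∀ n, 0 < ψ n) (k : ℕ) :
    q (k + 2) * min (ψ (q (k + 2))) ‖q (k + 1) • α‖ ≤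
      2 * ∑ n ∈ Finset.Ico (q k) (q (k + 2)), approxWeight ψ α n := by
  set m := min (ψ (q (k + 2))) ‖q (k + 1) • α‖
  have hm : 0 ≤ m := le_min (hpos _).le (norm_nonneg _)
  have h1 : (Finset.Ico (q k) (q (k + 2))).card • m ≤
      ∑ n ∈ Finset.Ico (q k) (q (k + 2)), approxWeight ψ α n := by
    refine Finset.card_nsmul_le_sum _ _ _ fun n hn => ?_
    rw [Finset.mem_Ico] at hn
    exact min_le_min (hψ hn.2.le) (h.norm_le_returnDist ((h.pos k).trans_le hn.1) hn.2)
  -- Denominators at least double every two steps, so the two blocks contain at least `q (k + 2) /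
  -- 2` indices.
  have h2 := h.two_mul_le k
  rw [Nat.card_Ico, nsmul_eq_mul, Nat.cast_sub (by omega)] at h1
  have h3 : (2 * q k : ℝ) ≤ q (k + 2) := by exact_mod_cast h2
  nlinarith

end IsReturnSequence

end Weights

/-! ### Arcs of the circle -/

theorem volume_real_closedBall (x : UnitAddCircle) {ρ : ℝ} (hρ : 0 ≤ ρ) :
    volume.real (Metric.closedBall x ρ) = min 1 (2 * ρ) := by
  rw [Measure.real, AddCircle.volume_closedBall, ENNReal.toReal_ofReal]
  positivity

/-- If `d = dist x y ≤ ρ`, the arc of radius `ρ - d / 2` about the midpoint of `x` and `y` lies in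
both arcs, so little of the first is left uncovered. -/
theorem volume_real_closedBall_diff_le (x y : UnitAddCircle) {ρ ρ' : ℝ} (hρ : 0 ≤ ρ)
    (hρ' : ρ ≤ ρ') :
    volume.real (Metric.closedBall x ρ \ Metric.closedBall y ρ') ≤ 2 * min ρ (dist x y) := by
  have hsub : volume.real (Metric.closedBall x ρ \ Metric.closedBall y ρ') ≤ 2 * ρ := by
    refine (measureReal_mono sdiff_subset).trans ?_
    rw [volume_real_closedBall x hρ]
    exact min_le_right _ _
  rw [mul_min_of_nonneg _ _ (by norm_num : (0 : ℝ) ≤ 2)]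
  refine le_min hsub ?_
  rcases le_total ρ (dist x y) with hd | hd
  · linarith
  obtain ⟨t, ht, htn⟩ : ∃ t : ℝ, x - y = (t : UnitAddCircle) ∧ |t| = dist x y := by
    obtain ⟨t, ht⟩ := QuotientAddGroup.mk_surjective (x - y)
    refine ⟨t - round t, ?_, ?_⟩
    · rw [AddCircle.coe_sub, ← ht]
      have : ((round t : ℝ) : UnitAddCircle) = 0 := by
        rw [AddCircle.coe_eq_zero_iff]; exact ⟨round t, by simp⟩
      rw [this, sub_zero]
    · rw [dist_eq_norm, ← ht]
      exact (UnitAddCircle.norm_eq (x := t)).symm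
  set z : UnitAddCircle := y + ((t / 2 : ℝ) : UnitAddCircle) with hz
  have hhalf : ‖((t / 2 : ℝ) : UnitAddCircle)‖ ≤ dist x y / 2 := by
    rw [UnitAddCircle.norm_eq]
    refine (round_le _ 0).trans ?_
    rw [Int.cast_zero, sub_zero, abs_div, htn]; simp
  have hzy : dist z y ≤ dist x y / 2 := by
    rw [dist_eq_norm, hz, add_sub_cancel_left]; exact hhalf
  have hzx : dist z x ≤ dist x y / 2 := by
    have : z - x = -((t / 2 : ℝ) : UnitAddCircle) := by
      have hx : x = y + (t : UnitAddCircle) := by rw [← ht]; abel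
      have ht2 : (t : UnitAddCircle) = ((t / 2 : ℝ) : UnitAddCircle) + ((t / 2 : ℝ)) := by
        rw [← AddCircle.coe_add, add_halves]
      rw [hz, hx, ht2]; abel
    rw [dist_eq_norm, this, norm_neg]; exact hhalf
  have hin : Metric.closedBall z (ρ - dist x y / 2) ⊆ Metric.closedBall x ρ :=
    Metric.closedBall_subset_closedBall' (by linarith)
  have hin' : Metric.closedBall z (ρ - dist x y / 2) ⊆ Metric.closedBall y ρ' :=
    Metric.closedBall_subset_closedBall' (by linarith)
  have hd0 : 0 ≤ dist x y := dist_nonneg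
  calc volume.real (Metric.closedBall x ρ \ Metric.closedBall y ρ')
      ≤ volume.real (Metric.closedBall x ρ \ Metric.closedBall z (ρ - dist x y / 2)) :=
        measureReal_mono (sdiff_subset_sdiff_right hin')
    _ = min 1 (2 * ρ) - min 1 (2 * (ρ - dist x y / 2)) := by
        rw [measureReal_sdiff hin Metric.isClosed_closedBall.measurableSet,
          volume_real_closedBall x hρ, volume_real_closedBall z (by linarith)]
    _ ≤ 2 * dist x y := by
        rcases min_cases (1 : ℝ) (2 * ρ) with ⟨h1, h2⟩ | ⟨h1, h2⟩ <;>
        rcases min_cases (1 : ℝ) (2 * (ρ - dist x y / 2)) with ⟨h3, h4⟩ | ⟨h3, h4⟩ <;>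
        rw [h1, h3] <;> linarith

/-! ### The convergence case -/

section Convergence

variable {α : UnitAddCircle} {q : ℕ → ℕ} {ψ : ℕ → ℝ}

/-- The union of the arcs of radius `ψ j` around `j • α` for `a ≤ j < b`. -/
def arcUnion (α : UnitAddCircle) (ψ : ℕ → ℝ) (a b : ℕ) : Set UnitAddCircle :=
  ⋃ j ∈ Finset.Ico a b, Metric.closedBall (j • α) (ψ j)

theorem volume_arcUnion_succ_le {a n : ℕ} (han : a ≤ n) :
    volume.real (arcUnion α ψ a (n + 1)) ≤ volume.real (arcUnion α ψ a n) +
      volume.real (Metric.closedBall (n • α) (ψ n) \ arcUnion α ψ a n) := by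
  have : arcUnion α ψ a (n + 1) =
      arcUnion α ψ a n ∪ (Metric.closedBall (n • α) (ψ n) \ arcUnion α ψ a n) := by
    rw [union_sdiff_self, arcUnion, arcUnion, ← Finset.insert_Ico_right_eq_Ico_add_one han,
      Finset.set_biUnion_insert, union_comm]
  rw [this]
  exact measureReal_union_le _ _

theorem volume_arcUnion_le_sum {a b c : ℕ} (hab : a ≤ b) (hbc : b ≤ c) {e : ℕ → ℝ}
    (he : ∀ n ∈ Finset.Ico b c,
      volume.real (Metric.closedBall (n • α) (ψ n) \ arcUnion α ψ a n) ≤ e n) :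
    volume.real (arcUnion α ψ a c) ≤
      volume.real (arcUnion α ψ a b) + ∑ n ∈ Finset.Ico b c, e n := by
  induction c, hbc using Nat.le_induction with
  | base => simp
  | succ c hbc ih =>
    rw [Finset.sum_Ico_succ_top hbc]
    have h1 := ih fun n hn => he n (Finset.Ico_subset_Ico_right (Nat.le_succ c) hn)
    have h2 := he c (by simp [hbc])
    have h3 := volume_arcUnion_succ_le (α := α) (ψ := ψ) (hab.trans hbc)
    linarith

theorem volume_arc_diff_arcUnion_le (hψ : Antitone ψ) (hpos : ∀ n, 0 < ψ n) {a n m : ℕ}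
    (hm : 0 < m) (ham : a + m ≤ n) :
    volume.real (Metric.closedBall (n • α) (ψ n) \ arcUnion α ψ a n) ≤
      2 * min (ψ n) ‖m • α‖ := by
  have hsub : Metric.closedBall ((n - m) • α) (ψ (n - m)) ⊆ arcUnion α ψ a n := by
    intro x hx
    simp only [arcUnion, mem_iUnion]
    exact ⟨n - m, by rw [Finset.mem_Ico]; omega, hx⟩
  refine (measureReal_mono (sdiff_subset_sdiff_right hsub)).trans ?_
  refine (volume_real_closedBall_diff_le _ _ (hpos n).le (hψ (Nat.sub_le n m))).trans ?_
  have : dist (n • α) ((n - m) • α) = ‖m • α‖ := by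
    rw [dist_eq_norm]
    congr 1
    conv_lhs => rw [← Nat.sub_add_cancel (by omega : m ≤ n), Nat.add_sub_cancel, add_nsmul]
    abel
  rw [this]

/-! ### Measure of a union of arcs, block by block -/

namespace IsReturnSequence

variable (h : IsReturnSequence α q)
include h

/-- The comparison arc must have index at least `q (i + 2)`. Shifting by `q (k + 2)` is allowed once
`n ≥ 2 * q (k + 2)`; before that the shift is `q (k + 1)`; for `n < 2 * q (i + 2)` the whole arc is
counted. -/
theorem volume_new_arc_le (hψ : Antitone ψ) (hpos : ∀ n, 0 < ψ n) {i k n : ℕ} (hik : i ≤ k)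
    (hkn : q (k + 2) ≤ n) (hnk : n < q (k + 3)) :
    volume.real (Metric.closedBall (n • α) (ψ n) \ arcUnion α ψ (q (i + 2)) n) ≤
      (2 * approxWeight ψ α n + if n < 2 * q (i + 2) then 2 * ψ (q (i + 2)) else 0) +
        if n < 2 * q (k + 2) then 2 * min (ψ (q (k + 2))) ‖q (k + 1) • α‖ else 0 := by
  have hg := approxWeight_nonneg hpos α n
  have hm : 0 ≤ min (ψ (q (k + 2))) ‖q (k + 1) • α‖ := le_min (hpos _).le (norm_nonneg _)
  have hJ := hpos (q (i + 2))
  have hikq : q (i + 2) ≤ q (k + 2) := h.mono (by omega)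
  by_cases h1 : n < 2 * q (i + 2)
  · have : volume.real (Metric.closedBall (n • α) (ψ n) \ arcUnion α ψ (q (i + 2)) n) ≤
        2 * ψ (q (i + 2)) := by
      refine (measureReal_mono sdiff_subset).trans ?_
      rw [volume_real_closedBall _ (hpos n).le]
      have := hψ (hikq.trans hkn)
      exact (min_le_right _ _).trans (by linarith)
    rw [if_pos h1]
    split_ifs <;> linarith
  · rw [if_neg h1]
    by_cases h2 : n < 2 * q (k + 2)
    · rw [if_pos h2]
      have hlt : i < k := by
        by_contra hc
        have : i = k := by omega
        subst this; omega
      obtain ⟨l, rfl⟩ : ∃ l, k = l + 1 := ⟨k - 1, by omega⟩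
      -- For `i = l` this is `2 * q (i + 2) ≤ n`; for `i < l` it follows from `q (l + 1) + q (l + 2)
      -- ≤ q (l + 3)`.
      have hshift : q (i + 2) + q (l + 1 + 1) ≤ n := by
        rcases eq_or_lt_of_le (by omega : i ≤ l) with rfl | hil
        · simp only [Nat.add_assoc, Nat.reduceAdd] at *; omega
        · have h3 : q (i + 2) ≤ q (l + 1) := h.mono (by omega)
          have h4 := h.add_le (l + 1)
          simp only [Nat.add_assoc, Nat.reduceAdd] at *; omega
      have h5 := volume_arc_diff_arcUnion_le (α := α) hψ hpos (h.pos _) hshift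
      have h6 : min (ψ n) ‖q (l + 1 + 1) • α‖ ≤
          min (ψ (q (l + 1 + 2))) ‖q (l + 1 + 1) • α‖ := min_le_min_right _ (hψ hkn)
      linarith
    · rw [if_neg h2]
      have h5 := volume_arc_diff_arcUnion_le (α := α) hψ hpos (h.pos (k + 2))
        (a := q (i + 2)) (n := n) (by omega)
      rw [approxWeight, h.returnDist_eq hkn hnk]
      linarith

theorem volume_arcUnion_block_le (hψ : Antitone ψ) (hpos : ∀ n, 0 < ψ n) {i k : ℕ} (hik : i ≤ k) :
    volume.real (arcUnion α ψ (q (i + 2)) (q (k + 3))) ≤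
      volume.real (arcUnion α ψ (q (i + 2)) (q (k + 2))) +
        (∑ n ∈ Finset.Ico (q (k + 2)) (q (k + 3)),
          (2 * approxWeight ψ α n + if n < 2 * q (i + 2) then 2 * ψ (q (i + 2)) else 0) +
        4 * ∑ n ∈ Finset.Ico (q k) (q (k + 2)), approxWeight ψ α n) := by
  refine (volume_arcUnion_le_sum (h.mono (by omega)) (h.mono (by omega)) fun n hn =>
    h.volume_new_arc_le hψ hpos hik (Finset.mem_Ico.1 hn).1 (Finset.mem_Ico.1 hn).2).trans ?_
  rw [Finset.sum_add_distrib]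
  gcongr
  rw [← Finset.sum_filter, Finset.sum_const, nsmul_eq_mul]
  have hcard : (({n ∈ Finset.Ico (q (k + 2)) (q (k + 3)) | n < 2 * q (k + 2)}.card : ℕ) : ℝ) ≤
      q (k + 2) := by
    have : {n ∈ Finset.Ico (q (k + 2)) (q (k + 3)) | n < 2 * q (k + 2)} ⊆
        Finset.Ico (q (k + 2)) (2 * q (k + 2)) := by
      intro n hn
      simp only [Finset.mem_filter, Finset.mem_Ico] at hn ⊢
      omega
    have := Finset.card_le_card this
    rw [Nat.card_Ico] at this
    exact_mod_cast this.trans (by omega)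
  have hm : 0 ≤ min (ψ (q (k + 2))) ‖q (k + 1) • α‖ := le_min (hpos _).le (norm_nonneg _)
  have := h.mul_min_le hψ hpos k
  nlinarith

/-- The constant is `10 = 2 + 4 * 2`: each weight is paid for in its own block, and again as part of
at most two pairs of consecutive blocks. -/
theorem volume_arcUnion_le (hψ : Antitone ψ) (hpos : ∀ n, 0 < ψ n)
    (hsum : Summable (approxWeight ψ α)) (i t : ℕ) :
    volume.real (arcUnion α ψ (q (i + 2)) (q (i + 2 + t))) ≤
      2 * (q (i + 2) * ψ (q (i + 2))) +
        10 * (∑' n, approxWeight ψ α n - ∑ n ∈ Finset.range (q i), approxWeight ψ α n) := by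
  set g := approxWeight ψ α with hgdef
  set G : ℕ → ℝ := fun m => ∑ n ∈ Finset.range m, g n with hG
  have hg0 : ∀ n, 0 ≤ g n := approxWeight_nonneg hpos α
  have hGmono : Monotone G := fun a b hab =>
    Finset.sum_le_sum_of_subset_of_nonneg (Finset.range_mono hab) fun n _ _ => hg0 n
  have hIco : ∀ {a b}, a ≤ b → ∑ n ∈ Finset.Ico a b, g n = G b - G a := fun hab =>
    Finset.sum_Ico_eq_sub _ hab
  set c : ℕ → ℝ := fun n => if n < 2 * q (i + 2) then 2 * ψ (q (i + 2)) else 0 with hc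
  have hc0 : ∀ n, 0 ≤ c n := fun n => by
    have := hpos (q (i + 2))
    simp only [hc]; split_ifs <;> linarith
  have key : volume.real (arcUnion α ψ (q (i + 2)) (q (i + 2 + t))) ≤
      ∑ n ∈ Finset.Ico (q (i + 2)) (q (i + 2 + t)), (2 * g n + c n) +
        4 * (G (q (i + 1 + t)) + G (q (i + t)) - G (q (i + 1)) - G (q i)) := by
    induction t with
    | zero => simp [arcUnion]
    | succ t ih =>
      have h1 := h.volume_arcUnion_block_le hψ hpos (i := i) (k := i + t) (by omega)
      have e1 : i + 2 + (t + 1) = i + t + 3 := by omega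
      have e2 : i + 2 + t = i + t + 2 := by omega
      have e3 : i + 1 + (t + 1) = i + t + 2 := by omega
      have e4 : i + 1 + t = i + t + 1 := by omega
      have e5 : i + (t + 1) = i + t + 1 := by omega
      rw [e2, e4] at ih
      rw [e1, e3, e5]
      rw [← Finset.sum_Ico_consecutive _ (h.mono (by omega) : q (i + 2) ≤ q (i + t + 2))
        (h.mono (by omega) : q (i + t + 2) ≤ q (i + t + 3))]
      rw [hIco (h.mono (by omega) : q (i + t) ≤ q (i + t + 2))] at h1
      linarith
  refine key.trans ?_
  have hcsum : ∑ n ∈ Finset.Ico (q (i + 2)) (q (i + 2 + t)), c n ≤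
      2 * (q (i + 2) * ψ (q (i + 2))) := by
    rw [← Finset.sum_filter, Finset.sum_const, nsmul_eq_mul]
    have : {n ∈ Finset.Ico (q (i + 2)) (q (i + 2 + t)) | n < 2 * q (i + 2)} ⊆
        Finset.Ico (q (i + 2)) (2 * q (i + 2)) := by
      intro n hn
      simp only [Finset.mem_filter, Finset.mem_Ico] at hn ⊢
      omega
    have := Finset.card_le_card this
    rw [Nat.card_Ico] at this
    have h3 : (({n ∈ Finset.Ico (q (i + 2)) (q (i + 2 + t)) |
        n < 2 * q (i + 2)}.card : ℕ) : ℝ) ≤ q (i + 2) := by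
      exact_mod_cast this.trans (by omega)
    nlinarith [hpos (q (i + 2))]
  rw [Finset.sum_add_distrib, ← Finset.mul_sum, hIco (h.mono (by omega))]
  have hle : ∀ m, G m ≤ ∑' n, g n := fun m => hsum.sum_le_tsum _ fun n _ => hg0 n
  have a1 := hle (q (i + 2 + t))
  have a2 := hle (q (i + 1 + t))
  have a3 := hle (q (i + t))
  have a4 : G (q i) ≤ G (q (i + 2)) := hGmono (h.mono (by omega))
  have a5 : G (q i) ≤ G (q (i + 1)) := hGmono (h.mono (by omega))
  have a6 : (∑ n ∈ Finset.range (q i), g n) = G (q i) := rfl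
  rw [a6]
  linarith

/-- By `mul_min_le` the product of `q (i + 2)` with the minimum tends to `0`. Since `half_le` keeps
`q (i + 2) * ‖q (i + 1) • α‖` above `1/2`, the minimum is eventually controlled through `ψ`. -/
theorem tendsto_mul_psi (hψ : Antitone ψ) (hpos : ∀ n, 0 < ψ n)
    (hsum : Summable (approxWeight ψ α)) :
    Tendsto (fun i => (q (i + 2) : ℝ) * ψ (q (i + 2))) atTop (𝓝 0) := by
  have hG := hsum.hasSum.tendsto_sum_nat.comp h.tendsto_atTop
  have hlim : Tendsto (fun i => 2 * (∑ n ∈ Finset.range (q (i + 2)), approxWeight ψ α n -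
      ∑ n ∈ Finset.range (q i), approxWeight ψ α n)) atTop (𝓝 0) := by
    have := ((hG.comp (tendsto_add_atTop_nat 2)).sub hG).const_mul 2
    simpa using this
  refine tendsto_of_tendsto_of_tendsto_of_le_of_le' tendsto_const_nhds hlim
    (Eventually.of_forall fun i => mul_nonneg (Nat.cast_nonneg _) (hpos _).le) ?_
  filter_upwards [hlim.eventually (gt_mem_nhds (by norm_num : (0 : ℝ) < 1 / 2))] with i hi
  have h1 := h.mul_min_le hψ hpos i
  rw [Finset.sum_Ico_eq_sub _ (h.mono (by omega : i ≤ i + 2)),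
    mul_min_of_nonneg _ _ (Nat.cast_nonneg _)] at h1
  have h2 := h.half_le (i + 1) (by omega)
  rcases min_le_iff.1 h1 with h3 | h3
  · exact h3
  · exact absurd (h2.trans h3) (not_le.2 hi)

/-- If the weights are summable, almost no point lies in infinitely many arcs. -/
theorem ae_not_frequently (hψ : Antitone ψ) (hpos : ∀ n, 0 < ψ n)
    (hsum : Summable (approxWeight ψ α)) :
    ∀ᵐ x : UnitAddCircle, ¬ ∃ᶠ n in atTop, x ∈ Metric.closedBall (n • α) (ψ n) := by
  rw [ae_iff]
  simp only [not_not]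
  set S := {x : UnitAddCircle | ∃ᶠ n in atTop, x ∈ Metric.closedBall (n • α) (ψ n)} with hS
  set b : ℕ → ℝ := fun i => 2 * (q (i + 2) * ψ (q (i + 2))) +
        10 * (∑' n, approxWeight ψ α n - ∑ n ∈ Finset.range (q i), approxWeight ψ α n) with hb
  have hblim : Tendsto b atTop (𝓝 0) := by
    have h1 := (h.tendsto_mul_psi hψ hpos hsum).const_mul 2
    have h2 := ((hsum.hasSum.tendsto_sum_nat.comp h.tendsto_atTop).const_sub
      (∑' n, approxWeight ψ α n)).const_mul 10
    simpa using h1.add h2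
  have hle : ∀ i, volume S ≤ ENNReal.ofReal (b i) := by
    intro i
    have hsub : S ⊆ ⋃ t, arcUnion α ψ (q (i + 2)) (q (i + 2 + t)) := by
      intro x hx
      obtain ⟨n, hn, hxn⟩ := (frequently_atTop.1 hx) (q (i + 2))
      simp only [arcUnion, mem_iUnion]
      refine ⟨n + 1, n, ?_, hxn⟩
      rw [Finset.mem_Ico]
      refine ⟨hn, ?_⟩
      have := h.le_self (i + 2 + (n + 1))
      omega
    have hmono : Monotone fun t => arcUnion α ψ (q (i + 2)) (q (i + 2 + t)) := by
      intro s t hst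
      refine biUnion_subset_biUnion_left fun n hn => ?_
      exact Finset.Ico_subset_Ico_right (h.mono (by omega)) hn
    refine (measure_mono hsub).trans (le_of_tendsto' (tendsto_measure_iUnion_atTop hmono) ?_)
    intro t
    have := h.volume_arcUnion_le hψ hpos hsum i t
    rw [Function.comp_apply, ← ofReal_measureReal]
    exact ENNReal.ofReal_le_ofReal this
  have h0 : volume S ≤ 0 := by
    have hlim := ENNReal.tendsto_ofReal hblim
    rw [ENNReal.ofReal_zero] at hlim
    exact ge_of_tendsto' hlim hle
  exact le_antisymm h0 zero_le

end IsReturnSequence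

end Convergence
/-! ### The divergence case -/

/-- The Chung–Erdős inequality. -/
theorem sq_sum_measureReal_le {Ω ι : Type*} [MeasurableSpace Ω] (μ : Measure Ω)
    [IsFiniteMeasure μ] (s : Finset ι) {B : ι → Set Ω} (hB : ∀ i ∈ s, MeasurableSet (B i)) :
    (∑ i ∈ s, μ.real (B i)) ^ 2 ≤
      μ.real (⋃ i ∈ s, B i) * ∑ i ∈ s, ∑ j ∈ s, μ.real (B i ∩ B j) := by
  set U := ⋃ i ∈ s, B i with hU
  have hUm : MeasurableSet U := s.measurableSet_biUnion hB
  have hsub : ∀ i ∈ s, B i ⊆ U := fun i hi => subset_biUnion_of_mem (u := B) hi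
  set S := ∑ i ∈ s, μ.real (B i) with hS
  set Q := ∑ i ∈ s, ∑ j ∈ s, μ.real (B i ∩ B j) with hQ
  have hint : ∀ {A : Set Ω}, MeasurableSet A → Integrable (A.indicator (1 : Ω → ℝ)) μ :=
    fun hA => (integrable_const (1 : ℝ)).indicator hA
  have hval : ∀ {A : Set Ω}, MeasurableSet A → ∫ x, A.indicator (1 : Ω → ℝ) x ∂μ = μ.real A :=
    fun hA => integral_indicator_one hA
  -- Integrate the square of `∑ 1_{B i} - c 1_U`; the choice `c = S / μ U` will be optimal.
  have key : ∀ c : ℝ, 0 ≤ Q - 2 * c * S + c ^ 2 * μ.real U := by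
    intro c
    have hpt : ∀ x, (∑ i ∈ s, (B i).indicator (1 : Ω → ℝ) x -
        c * U.indicator (1 : Ω → ℝ) x) ^ 2 =
        (∑ i ∈ s, ∑ j ∈ s, (B i ∩ B j).indicator (1 : Ω → ℝ) x) -
          2 * c * (∑ i ∈ s, (B i).indicator (1 : Ω → ℝ) x) +
          c ^ 2 * U.indicator (1 : Ω → ℝ) x := by
      intro x
      have h1 : ∑ i ∈ s, ∑ j ∈ s, (B i ∩ B j).indicator (1 : Ω → ℝ) x =
          (∑ i ∈ s, (B i).indicator (1 : Ω → ℝ) x) *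
            ∑ i ∈ s, (B i).indicator (1 : Ω → ℝ) x := by
        rw [Finset.sum_mul_sum]
        refine Finset.sum_congr rfl fun i _ => Finset.sum_congr rfl fun j _ => ?_
        rw [inter_indicator_one]; rfl
      rw [h1]
      by_cases hx : x ∈ U
      · rw [indicator_of_mem hx]; simp only [Pi.one_apply]; ring
      · have : ∑ i ∈ s, (B i).indicator (1 : Ω → ℝ) x = 0 :=
          Finset.sum_eq_zero fun i hi => indicator_of_notMem (fun h => hx (hsub i hi h)) _
        rw [this, indicator_of_notMem hx]; ring
    have h0 : 0 ≤ ∫ x, (∑ i ∈ s, (B i).indicator (1 : Ω → ℝ) x -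
        c * U.indicator (1 : Ω → ℝ) x) ^ 2 ∂μ := integral_nonneg fun x => sq_nonneg _
    have hI1 : Integrable (fun x => ∑ i ∈ s, ∑ j ∈ s, (B i ∩ B j).indicator (1 : Ω → ℝ) x) μ :=
      integrable_finsetSum _ fun i hi => integrable_finsetSum _ fun j hj =>
        hint ((hB i hi).inter (hB j hj))
    have hI2 : Integrable (fun x => ∑ i ∈ s, (B i).indicator (1 : Ω → ℝ) x) μ :=
      integrable_finsetSum _ fun i hi => hint (hB i hi)
    simp only [hpt] at h0
    have hadd := integral_add (hI1.sub (hI2.const_mul (2 * c))) ((hint hUm).const_mul (c ^ 2))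
    simp only [Pi.sub_apply] at hadd
    rw [hadd, integral_sub hI1 (hI2.const_mul _), integral_const_mul, integral_const_mul, hval hUm,
      integral_finsetSum _ fun i hi => hint (hB i hi),
      integral_finsetSum _ fun i hi => integrable_finsetSum _ fun j hj =>
        hint ((hB i hi).inter (hB j hj)),
      Finset.sum_congr rfl fun i hi => hval (hB i hi),
      Finset.sum_congr rfl fun i hi => (integral_finsetSum _ fun j hj =>
        hint ((hB i hi).inter (hB j hj))).trans
          (Finset.sum_congr rfl fun j hj => hval ((hB i hi).inter (hB j hj)))] at h0
    exact h0
  rcases (measureReal_nonneg (μ := μ) (s := U)).eq_or_lt with h0 | hpos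
  · have : S = 0 := Finset.sum_eq_zero fun i hi =>
      le_antisymm (h0 ▸ measureReal_mono (hsub i hi) (measure_ne_top μ U)) measureReal_nonneg
    rw [this, ← h0]; simp
  · have := key (S / μ.real U)
    have h2 : Q - 2 * (S / μ.real U) * S + (S / μ.real U) ^ 2 * μ.real U =
        (μ.real U * Q - S ^ 2) / μ.real U := by
      field_simp; ring
    rw [h2] at this
    have := (div_nonneg_iff.1 this).resolve_right fun h => absurd h.2 (not_le.2 hpos)
    linarith [this.1]

/-- If `p` holds at most `c` times on every window of length `L`, the sum of an antitone sequence
over the places where `p` holds is at most `c / L` times the full sum, extended by `L`. -/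
theorem mul_sum_filter_le_of_antitone {g : ℕ → ℝ} (hg : Antitone g) (hg0 : ∀ n, 0 ≤ g n)
    (p : ℕ → Prop) [DecidablePred p] {L a b : ℕ} (hLa : L ≤ a) {c : ℝ}
    (hc : ∀ t, (({m ∈ Finset.Ioc t (t + L) | p m}.card : ℕ) : ℝ) ≤ c) :
    L * ∑ m ∈ Finset.Ico a b with p m, g m ≤ c * ∑ t ∈ Finset.Ico (a - L) b, g t := by
  -- Spread each term over the `L` indices before it; after exchanging sums, each `t` is hit only
  -- from the window `(t, t + L]`.
  have h1 : ∀ m ∈ {m ∈ Finset.Ico a b | p m}, L * g m ≤ ∑ t ∈ Finset.Ico (m - L) m, g t := by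
    intro m hm
    simp only [Finset.mem_filter, Finset.mem_Ico] at hm
    have : (Finset.Ico (m - L) m).card • g m ≤ ∑ t ∈ Finset.Ico (m - L) m, g t :=
      Finset.card_nsmul_le_sum _ _ _ fun t ht => hg (Finset.mem_Ico.1 ht).2.le
    rw [Nat.card_Ico, nsmul_eq_mul] at this
    rwa [show m - (m - L) = L by omega] at this
  rw [Finset.mul_sum]
  refine (Finset.sum_le_sum h1).trans ?_
  rw [Finset.sum_comm' (t' := Finset.Ico (a - L) b)
    (s' := fun t => {m ∈ Finset.Ico a b | p m ∧ t < m ∧ m ≤ t + L})]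
  · rw [Finset.mul_sum]
    refine Finset.sum_le_sum fun t _ => ?_
    rw [Finset.sum_const, nsmul_eq_mul]
    refine mul_le_mul_of_nonneg_right (le_trans ?_ (hc t)) (hg0 t)
    refine Nat.cast_le.2 (Finset.card_le_card fun m hm => ?_)
    simp only [Finset.mem_filter, Finset.mem_Ioc, Finset.mem_Ico] at hm ⊢
    tauto
  · intro m t
    simp only [Finset.mem_filter, Finset.mem_Ico]
    constructor
    · rintro ⟨⟨⟨h1, h2⟩, h3⟩, h4, h5⟩
      exact ⟨⟨⟨h1, h2⟩, h3, h5, by omega⟩, by omega, by omega⟩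
    · rintro ⟨⟨⟨h1, h2⟩, h3, h5, h6⟩, h7, h8⟩
      exact ⟨⟨⟨h1, h2⟩, h3⟩, by omega, h5⟩

/-- A packing bound for separated points in an arc. -/
theorem card_mul_le_of_separated {ι : Type*} {A : Finset ι} {u : ι → UnitAddCircle}
    {x : UnitAddCircle} {D ρ : ℝ} (hD : 0 < D) (hD1 : D ≤ 1 / 2) (hDρ : D ≤ 2 * ρ)
    (hsep : ∀ i ∈ A, ∀ j ∈ A, i ≠ j → D ≤ dist (u i) (u j)) (hin : ∀ i ∈ A, dist x (u i) ≤ ρ) :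
    A.card * D ≤ 5 * ρ := by
  -- Radius `D / 3` makes the closed arcs disjoint. Comparing lengths gives `A.card * D ≤ 3 * ρ + D
  -- ≤ 5 * ρ`.
  have hdisj : (A : Set ι).PairwiseDisjoint fun i => Metric.closedBall (u i) (D / 3) := by
    intro i hi j hj hij
    refine Metric.closedBall_disjoint_closedBall ?_
    have := hsep i hi j hj hij
    linarith
  have h1 := measureReal_biUnion_finset (μ := (volume : Measure UnitAddCircle)) hdisj
    fun i _ => Metric.isClosed_closedBall.measurableSet
  have h2 : ⋃ i ∈ A, Metric.closedBall (u i) (D / 3) ⊆ Metric.closedBall x (ρ + D / 3) := by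
    refine iUnion₂_subset fun i hi => Metric.closedBall_subset_closedBall' ?_
    have := hin i hi
    rw [dist_comm] at this
    linarith
  have h3 := measureReal_mono (μ := (volume : Measure UnitAddCircle)) h2
  rw [h1, volume_real_closedBall _ (by linarith)] at h3
  simp only [volume_real_closedBall _ (by linarith : (0 : ℝ) ≤ D / 3)] at h3
  rw [min_eq_right (by linarith), Finset.sum_const, nsmul_eq_mul] at h3
  have h4 := h3.trans (min_le_right _ _)
  nlinarith

theorem dist_nsmul_nsmul (α : UnitAddCircle) {n m : ℕ} (h : n ≤ m) :
    dist (n • α) (m • α) = ‖(m - n) • α‖ := by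
  rw [dist_comm, dist_eq_norm, sub_nsmul α h, sub_eq_add_neg]

/-- The arc around `n • α` of total length half the `n`-th weight. -/
def weightArc (ψ : ℕ → ℝ) (α : UnitAddCircle) (n : ℕ) : Set UnitAddCircle :=
  Metric.closedBall (n • α) (approxWeight ψ α n / 4)

/-- The points that lie within `ψ n` of `n • α` for infinitely many `n`. -/
def approxSet (ψ : ℕ → ℝ) (α : UnitAddCircle) : Set UnitAddCircle :=
  {x | ∃ᶠ n in atTop, x ∈ Metric.ball (n • α) (ψ n)}

section Divergence

variable {α : UnitAddCircle} {q : ℕ → ℕ} {ψ : ℕ → ℝ}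

theorem measurableSet_weightArc (ψ : ℕ → ℝ) (α : UnitAddCircle) (n : ℕ) :
    MeasurableSet (weightArc ψ α n) :=
  Metric.isClosed_closedBall.measurableSet

theorem volume_weightArc (hpos : ∀ n, 0 < ψ n) (n : ℕ) :
    volume.real (weightArc ψ α n) = approxWeight ψ α n / 2 := by
  have h0 := approxWeight_nonneg hpos α n
  have h1 : approxWeight ψ α n ≤ 1 / 2 := (min_le_right _ _).trans (returnDist_le_half α n)
  rw [weightArc, volume_real_closedBall _ (by linarith), min_eq_right (by linarith)]
  ring

theorem volume_weightArc_inter_le (hψ : Antitone ψ) (hpos : ∀ n, 0 < ψ n) {n m : ℕ}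
    (hnm : n ≤ m) :
    volume.real (weightArc ψ α n ∩ weightArc ψ α m) ≤
      if dist (n • α) (m • α) ≤ approxWeight ψ α n / 2 then approxWeight ψ α m / 2 else 0 := by
  split_ifs with hd
  · rw [← volume_weightArc hpos m]
    exact measureReal_mono inter_subset_right
  · have : Disjoint (weightArc ψ α n) (weightArc ψ α m) := by
      refine Metric.closedBall_disjoint_closedBall ?_
      have := approxWeight_antitone hψ α hnm
      rw [not_le] at hd
      linarith
    rw [this.inter_eq]; simp

/-! ### Pairwise overlaps and positive measure of the limsup set -/

namespace IsReturnSequence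

variable (h : IsReturnSequence α q)
include h

theorem norm_le_dist {k n m : ℕ} (hnm : n < m) (hm : m - n < q (k + 1)) :
    ‖q k • α‖ ≤ dist (n • α) (m • α) := by
  rw [dist_nsmul_nsmul α hnm.le]
  exact h.norm_le k _ (by omega) hm

theorem norm_le_dist_of_ne {k n m : ℕ} (hne : n ≠ m) (hm : m < n + q (k + 1))
    (hn : n < m + q (k + 1)) : ‖q k • α‖ ≤ dist (n • α) (m • α) := by
  rcases lt_or_gt_of_ne hne with hlt | hlt
  · exact h.norm_le_dist hlt (by omega)
  · rw [dist_comm]; exact h.norm_le_dist hlt (by omega)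

open Classical in
/-- Overlaps of the arc at `m` with all earlier arcs. -/
theorem sum_inter_le (hψ : Antitone ψ) (hpos : ∀ n, 0 < ψ n) {k m : ℕ}
    (hkm : q (k + 2) ≤ m) (hmk : m < q (k + 3)) :
    ∑ n ∈ Finset.range m, volume.real (weightArc ψ α n ∩ weightArc ψ α m) ≤
      approxWeight ψ α m / 2 + ∑ n ∈ Finset.range (q (k + 2)),
        if ‖q (k + 1) • α‖ ≤ approxWeight ψ α n ∧ dist (n • α) (m • α) ≤ approxWeight ψ α n / 2
        then approxWeight ψ α m / 2 else 0 := by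
  set g := approxWeight ψ α with hg
  have hg0 : ∀ n, 0 ≤ g n := approxWeight_nonneg hpos α
  have hanti : Antitone g := approxWeight_antitone hψ α
  have hterm := fun n (hn : n ≤ m) => volume_weightArc_inter_le (α := α) hψ hpos hn
  rw [← Finset.sum_range_add_sum_Ico _ hkm]
  -- Two points of the same block are at least `‖q (k + 2) • α‖ ≥ g n` apart, so their arcs do not
  -- overlap unless the weights vanish.
  have hlate : ∑ n ∈ Finset.Ico (q (k + 2)) m,
      volume.real (weightArc ψ α n ∩ weightArc ψ α m) ≤ 0 := by
    refine Finset.sum_nonpos fun n hn => ?_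
    rw [Finset.mem_Ico] at hn
    refine (hterm n hn.2.le).trans ?_
    split_ifs with hd
    · have h1 : ‖q (k + 2) • α‖ ≤ dist (n • α) (m • α) :=
        h.norm_le_dist hn.2 ((Nat.sub_le _ _).trans_lt hmk)
      have h2 : g n ≤ ‖q (k + 2) • α‖ := by
        rw [← h.returnDist_eq hn.1 (hn.2.trans hmk)]
        exact min_le_right _ _
      have h3 := hanti hn.2.le
      have h4 : g n ≤ g n / 2 := h2.trans (h1.trans hd)
      change g m / 2 ≤ 0
      linarith
    · exact le_rfl
  set A := {n ∈ Finset.range (q (k + 2)) |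
    g n < ‖q (k + 1) • α‖ ∧ dist (n • α) (m • α) ≤ g n / 2} with hA
  -- Points of index below `q (k + 2)` are `‖q (k + 1) • α‖`-separated, so only one arc of smaller
  -- weight can reach `m • α`.
  have hcard : A.card ≤ 1 := by
    refine Finset.card_le_one.2 fun n hn l hl => ?_
    simp only [hA, Finset.mem_filter, Finset.mem_range] at hn hl
    by_contra hne
    have h1 : ‖q (k + 1) • α‖ ≤ dist (n • α) (l • α) :=
      h.norm_le_dist_of_ne hne (hl.1.trans_le (Nat.le_add_left _ _))
        (hn.1.trans_le (Nat.le_add_left _ _))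
    have h2 := dist_triangle_right (n • α) (l • α) (m • α)
    linarith
  have hsplit : ∑ n ∈ Finset.range (q (k + 2)),
      volume.real (weightArc ψ α n ∩ weightArc ψ α m) ≤
      ∑ n ∈ Finset.range (q (k + 2)),
        ((if g n < ‖q (k + 1) • α‖ ∧ dist (n • α) (m • α) ≤ g n / 2 then g m / 2 else 0) +
        if ‖q (k + 1) • α‖ ≤ g n ∧ dist (n • α) (m • α) ≤ g n / 2 then g m / 2 else 0) := by
    refine Finset.sum_le_sum fun n hn => ?_
    refine (hterm n ((Finset.mem_range.1 hn).le.trans hkm)).trans ?_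
    have := hg0 m
    by_cases h1 : g n < ‖q (k + 1) • α‖
    · simp [← hg, h1, not_le.2 h1]
    · simp [← hg, h1, not_lt.1 h1]
  rw [Finset.sum_add_distrib, ← Finset.sum_filter, ← hA, Finset.sum_const, nsmul_eq_mul] at hsplit
  have hc : (A.card : ℝ) ≤ 1 := by exact_mod_cast hcard
  have := mul_le_mul_of_nonneg_right hc (by linarith [hg0 m] : 0 ≤ g m / 2)
  linarith

open Classical in
/-- Weights of one block close to a fixed earlier point. -/
theorem sum_near_le (hψ : Antitone ψ) (hpos : ∀ n, 0 < ψ n) (k n : ℕ)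
    (hn : ‖q (k + 1) • α‖ ≤ approxWeight ψ α n) :
    ∑ m ∈ Finset.Ico (q (k + 2)) (q (k + 3)) with
        dist (n • α) (m • α) ≤ approxWeight ψ α n / 2, approxWeight ψ α m ≤
      10 * approxWeight ψ α n * ∑ t ∈ Finset.Ico (q k) (q (k + 3)), approxWeight ψ α t := by
  set g := approxWeight ψ α with hg
  have hg0 : ∀ n, 0 ≤ g n := approxWeight_nonneg hpos α
  have hhalf := h.half_le (k + 1) (by omega)
  have hqpos : (0 : ℝ) < q (k + 2) := by exact_mod_cast h.pos _
  have hDpos : 0 < ‖q (k + 1) • α‖ := by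
    by_contra hc
    nlinarith
  have hgn : g n ≤ 1 / 2 := (min_le_right _ _).trans (returnDist_le_half α n)
  have h2q := h.two_mul_le k
  -- The window has length at least `q (k + 2) / 2`, yet the extended sum starts only at `q k`, so
  -- it meets three blocks. The count comes from packing at separation `‖q (k + 1) • α‖ ≥ 1 / (2 * q
  -- (k + 2))`.
  have hwin := mul_sum_filter_le_of_antitone (g := g) (approxWeight_antitone hψ α) hg0
    (fun m => dist (n • α) (m • α) ≤ g n / 2) (L := q (k + 2) - q k) (a := q (k + 2))
    (b := q (k + 3)) (c := 5 * g n * q (k + 2)) (Nat.sub_le _ _) fun t => by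
      have hpack := card_mul_le_of_separated
        (A := {m ∈ Finset.Ioc t (t + (q (k + 2) - q k)) | dist (n • α) (m • α) ≤ g n / 2})
        (u := fun m : ℕ => m • α) (x := n • α) (D := ‖q (k + 1) • α‖) (ρ := g n / 2) hDpos
        (hn.trans hgn) (by linarith)
        (fun i hi j hj hij => by
          simp only [Finset.mem_filter, Finset.mem_Ioc] at hi hj
          have := h.pos k
          exact h.norm_le_dist_of_ne hij (by change j < i + q (k + 2); omega)
            (by change i < j + q (k + 2); omega))
        (fun i hi => (Finset.mem_filter.1 hi).2)
      set N : ℝ := (({m ∈ Finset.Ioc t (t + (q (k + 2) - q k)) |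
        dist (n • α) (m • α) ≤ g n / 2}.card : ℕ) : ℝ) with hN
      have hN0 : 0 ≤ N := Nat.cast_nonneg _
      calc N ≤ N * (2 * (q (k + 2) * ‖q (k + 1) • α‖)) := by nlinarith
        _ = 2 * q (k + 2) * (N * ‖q (k + 1) • α‖) := by ring
        _ ≤ 2 * q (k + 2) * (5 * (g n / 2)) := by gcongr
        _ = 5 * g n * q (k + 2) := by ring
  rw [show q (k + 2) - (q (k + 2) - q k) = q k by omega, Nat.cast_sub (by omega)] at hwin
  have h2q' : (2 * q k : ℝ) ≤ q (k + 2) := by exact_mod_cast h2q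
  set X := ∑ m ∈ Finset.Ico (q (k + 2)) (q (k + 3)) with dist (n • α) (m • α) ≤ g n / 2, g m
  set Y := ∑ t ∈ Finset.Ico (q k) (q (k + 3)), g t
  have hX : 0 ≤ X := Finset.sum_nonneg fun m _ => hg0 m
  have : (q (k + 2) : ℝ) * X ≤ q (k + 2) * (10 * g n * Y) := by nlinarith
  exact le_of_mul_le_mul_left this hqpos

theorem sum_block_inter_le (hψ : Antitone ψ) (hpos : ∀ n, 0 < ψ n) (k : ℕ) :
    ∑ m ∈ Finset.Ico (q (k + 2)) (q (k + 3)), ∑ n ∈ Finset.range m,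
        volume.real (weightArc ψ α n ∩ weightArc ψ α m) ≤
      (∑ m ∈ Finset.Ico (q (k + 2)) (q (k + 3)), approxWeight ψ α m) / 2 +
        5 * (∑ n ∈ Finset.range (q (k + 2)), approxWeight ψ α n) *
          ∑ t ∈ Finset.Ico (q k) (q (k + 3)), approxWeight ψ α t := by
  classical
  have hg0 : ∀ n, 0 ≤ approxWeight ψ α n := approxWeight_nonneg hpos α
  refine (Finset.sum_le_sum fun m hm =>
    h.sum_inter_le hψ hpos (Finset.mem_Ico.1 hm).1 (Finset.mem_Ico.1 hm).2).trans ?_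
  rw [Finset.sum_add_distrib, Finset.sum_div, Finset.sum_comm]
  gcongr
  rw [Finset.mul_sum (Finset.range _), Finset.sum_mul]
  refine Finset.sum_le_sum fun n _ => ?_
  by_cases hn : ‖q (k + 1) • α‖ ≤ approxWeight ψ α n
  · simp only [hn, true_and]
    rw [← Finset.sum_filter, ← Finset.sum_div]
    have := h.sum_near_le hψ hpos k n hn
    linarith
  · simp only [hn, false_and, if_false, Finset.sum_const_zero]
    have := Finset.sum_nonneg (s := Finset.Ico (q k) (q (k + 3))) fun t _ => hg0 t
    have := hg0 n
    positivity

theorem sum_inter_total_le (hψ : Antitone ψ) (hpos : ∀ n, 0 < ψ n) (K : ℕ) :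
    ∑ m ∈ Finset.Ico (q 2) (q (K + 2)), ∑ n ∈ Finset.range m,
        volume.real (weightArc ψ α n ∩ weightArc ψ α m) ≤
      (∑ n ∈ Finset.range (q (K + 2)), approxWeight ψ α n) / 2 +
        15 * (∑ n ∈ Finset.range (q (K + 2)), approxWeight ψ α n) ^ 2 := by
  set g := approxWeight ψ α with hgdef
  set G : ℕ → ℝ := fun m => ∑ n ∈ Finset.range m, g n with hG
  have hg0 : ∀ n, 0 ≤ g n := approxWeight_nonneg hpos α
  have hGmono : Monotone G := fun a b hab =>
    Finset.sum_le_sum_of_subset_of_nonneg (Finset.range_mono hab) fun n _ _ => hg0 n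
  have hG0 : ∀ m, 0 ≤ G m := fun m => Finset.sum_nonneg fun n _ => hg0 n
  have hIco : ∀ {a b}, a ≤ b → ∑ n ∈ Finset.Ico a b, g n = G b - G a := fun hab =>
    Finset.sum_Ico_eq_sub _ hab
  -- The differences `G (q (k + 3)) - G (q k)` telescope to three terms, whence `15 = 5 * 3`.
  have key : ∑ m ∈ Finset.Ico (q 2) (q (K + 2)), ∑ n ∈ Finset.range m,
        volume.real (weightArc ψ α n ∩ weightArc ψ α m) ≤
      G (q (K + 2)) / 2 +
        5 * G (q (K + 2)) * (G (q (K + 2)) + G (q (K + 1)) + G (q K)) := by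
    induction K with
    | zero =>
      simp only [Nat.zero_add, Finset.Ico_self, Finset.sum_empty]
      have := hG0 (q 2); have := hG0 (q 1); have := hG0 (q 0)
      positivity
    | succ K ih =>
      rw [← Finset.sum_Ico_consecutive _ (h.mono (by omega) : q 2 ≤ q (K + 2))
        (h.mono (by omega) : q (K + 2) ≤ q (K + 1 + 2))]
      have h1 := h.sum_block_inter_le hψ hpos K
      rw [hIco (h.mono (by omega)), hIco (h.mono (by omega))] at h1
      have e1 : K + 1 + 2 = K + 3 := by omega
      have e2 : K + 1 + 1 = K + 2 := by omega
      rw [e1, e2]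
      have a1 : G (q (K + 2)) ≤ G (q (K + 3)) := hGmono (h.mono (by omega))
      have a3 : G (q K) ≤ G (q (K + 3)) := hGmono (h.mono (by omega))
      have a4 := hG0 (q (K + 2))
      have a5 := hG0 (q (K + 1))
      have a6 := hG0 (q K)
      change _ ≤ (G (q (K + 3)) - G (q (K + 2))) / 2 +
        5 * G (q (K + 2)) * (G (q (K + 3)) - G (q K)) at h1
      have a7 : G (q (K + 2)) * (G (q (K + 3)) + G (q (K + 2)) + G (q (K + 1))) ≤
          G (q (K + 3)) * (G (q (K + 3)) + G (q (K + 2)) + G (q (K + 1))) :=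
        mul_le_mul_of_nonneg_right a1 (by linarith)
      linarith
  refine key.trans ?_
  have a1 : G (q (K + 1)) ≤ G (q (K + 2)) := hGmono (h.mono (by omega))
  have a2 : G (q K) ≤ G (q (K + 2)) := hGmono (h.mono (by omega))
  have a3 := hG0 (q (K + 2))
  change _ ≤ G (q (K + 2)) / 2 + 15 * G (q (K + 2)) ^ 2
  nlinarith

theorem sum_sum_inter_le (hψ : Antitone ψ) (hpos : ∀ n, 0 < ψ n) {M K : ℕ} (hM : q 2 ≤ M) :
    ∑ n ∈ Finset.Ico M (q (K + 2)), ∑ m ∈ Finset.Ico M (q (K + 2)),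
        volume.real (weightArc ψ α n ∩ weightArc ψ α m) ≤
      2 * (∑ n ∈ Finset.range (q (K + 2)), approxWeight ψ α n) +
        30 * (∑ n ∈ Finset.range (q (K + 2)), approxWeight ψ α n) ^ 2 := by
  set N := q (K + 2) with hN
  set F : ℕ → ℕ → ℝ := fun n m => volume.real (weightArc ψ α n ∩ weightArc ψ α m) with hF
  have hF0 : ∀ n m, 0 ≤ F n m := fun n m => measureReal_nonneg
  have hsymm : ∀ n m, F n m = F m n := fun n m => by simp only [hF, inter_comm]
  set P := ∑ m ∈ Finset.Ico M N, ∑ n ∈ Finset.Ico M m, F n m with hP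
  have hdecomp : ∑ n ∈ Finset.Ico M N, ∑ m ∈ Finset.Ico M N, F n m =
      2 * P + ∑ m ∈ Finset.Ico M N, F m m := by
    have h1 : ∀ n ∈ Finset.Ico M N, ∑ m ∈ Finset.Ico M N, F n m =
        ∑ m ∈ Finset.Ico M n, F n m + F n n + ∑ m ∈ Finset.Ico (n + 1) N, F n m := by
      intro n hn
      rw [Finset.mem_Ico] at hn
      rw [← Finset.sum_Ico_consecutive _ hn.1 hn.2.le, Finset.sum_eq_sum_Ico_succ_bot hn.2]
      ring
    rw [Finset.sum_congr rfl h1, Finset.sum_add_distrib, Finset.sum_add_distrib]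
    have h2 : ∑ n ∈ Finset.Ico M N, ∑ m ∈ Finset.Ico M n, F n m = P :=
      Finset.sum_congr rfl fun n _ => Finset.sum_congr rfl fun m _ => hsymm n m
    have h3 : ∑ n ∈ Finset.Ico M N, ∑ m ∈ Finset.Ico (n + 1) N, F n m = P := by
      rw [hP]
      refine Finset.sum_comm' fun n m => ?_
      simp only [Finset.mem_Ico]
      omega
    rw [h2, h3]; ring
  have hPle : P ≤ ∑ m ∈ Finset.Ico (q 2) N, ∑ n ∈ Finset.range m, F n m := by
    refine (Finset.sum_le_sum_of_subset_of_nonneg (Finset.Ico_subset_Ico_left hM)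
      fun m _ _ => Finset.sum_nonneg fun n _ => hF0 n m).trans ?_
    refine Finset.sum_le_sum fun m _ => ?_
    refine Finset.sum_le_sum_of_subset_of_nonneg (fun n hn => ?_) fun n _ _ => hF0 n m
    simp only [Finset.mem_Ico, Finset.mem_range] at hn ⊢
    exact hn.2
  have hdiag : ∑ m ∈ Finset.Ico M N, F m m ≤ (∑ n ∈ Finset.range N, approxWeight ψ α n) / 2 := by
    rw [Finset.sum_div]
    refine (Finset.sum_le_sum_of_subset_of_nonneg (fun n hn => ?_) fun n _ _ => hF0 n n).trans
      (Finset.sum_le_sum fun n _ => ?_)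
    · exact Finset.mem_range.2 (Finset.mem_Ico.1 hn).2
    · simp only [hF, inter_self]
      exact (volume_weightArc hpos n).le
  have htot := h.sum_inter_total_le hψ hpos K
  have hnn : 0 ≤ ∑ n ∈ Finset.range N, approxWeight ψ α n :=
    Finset.sum_nonneg fun n _ => approxWeight_nonneg hpos α n
  change ∑ n ∈ Finset.Ico M N, ∑ m ∈ Finset.Ico M N, F n m ≤ _
  rw [hdecomp]
  linarith

/-- Choose `K` so large that the indices from `M` on carry at least half of `G` and `G ≥ 1`.
Chung–Erdős then reads `(G / 4) ^ 2 ≤ u * 32 * G ^ 2`, and `512 = 16 * 32`. The bound does not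
depend on `M`, so it survives the passage to the limsup set. -/
theorem volume_iUnion_weightArc_ge (hψ : Antitone ψ) (hpos : ∀ n, 0 < ψ n)
    (hsum : ¬ Summable (approxWeight ψ α)) {M : ℕ} (hM : q 2 ≤ M) :
    1 / 512 ≤ volume.real (⋃ n ∈ Ici M, weightArc ψ α n) := by
  set g := approxWeight ψ α with hgdef
  have hg0 : ∀ n, 0 ≤ g n := approxWeight_nonneg hpos α
  have htend := (not_summable_iff_tendsto_nat_atTop_of_nonneg hg0).1 hsum
  have hcomp : Tendsto (fun K => ∑ n ∈ Finset.range (q (K + 2)), g n) atTop atTop :=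
    htend.comp (h.tendsto_atTop.comp (tendsto_add_atTop_nat 2))
  obtain ⟨K, hK1, hK2, hK3⟩ := ((hcomp.eventually_ge_atTop 1).and
    ((hcomp.eventually_ge_atTop (2 * ∑ n ∈ Finset.range M, g n)).and
      ((h.tendsto_atTop.comp (tendsto_add_atTop_nat 2)).eventually_ge_atTop M))).exists
  simp only [Function.comp_apply] at hK3
  set G := ∑ n ∈ Finset.range (q (K + 2)), g n with hG
  have hCE := sq_sum_measureReal_le (volume : Measure UnitAddCircle)
    (Finset.Ico M (q (K + 2))) fun n _ => measurableSet_weightArc ψ α n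
  have hQ := h.sum_sum_inter_le hψ hpos (K := K) hM
  have hS : G / 4 ≤ ∑ n ∈ Finset.Ico M (q (K + 2)), volume.real (weightArc ψ α n) := by
    rw [Finset.sum_congr rfl fun n _ => volume_weightArc hpos n, ← Finset.sum_div,
      Finset.sum_Ico_eq_sub _ hK3]
    change G / 4 ≤ (G - ∑ n ∈ Finset.range M, g n) / 2
    linarith
  have hU : volume.real (⋃ n ∈ Finset.Ico M (q (K + 2)), weightArc ψ α n) ≤
      volume.real (⋃ n ∈ Ici M, weightArc ψ α n) := by
    refine measureReal_mono (biUnion_subset_biUnion_left fun n hn => ?_) (measure_ne_top _ _)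
    exact (Finset.mem_Ico.1 hn).1
  refine le_trans ?_ hU
  set u := volume.real (⋃ n ∈ Finset.Ico M (q (K + 2)), weightArc ψ α n)
  have hu : 0 ≤ u := measureReal_nonneg
  have h1 : (G / 4) ^ 2 ≤ u * (2 * G + 30 * G ^ 2) :=
    (pow_le_pow_left₀ (by linarith) hS 2).trans
      (hCE.trans (mul_le_mul_of_nonneg_left hQ hu))
  have h2 : u * (2 * G + 30 * G ^ 2) ≤ u * (32 * G ^ 2) :=
    mul_le_mul_of_nonneg_left (by nlinarith) hu
  have hG2 : 0 < G ^ 2 := by positivity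
  by_contra hlt
  rw [not_le] at hlt
  nlinarith

theorem volume_approxSet_ne_zero (hψ : Antitone ψ) (hpos : ∀ n, 0 < ψ n)
    (hsum : ¬ Summable (approxWeight ψ α)) :
    volume (approxSet ψ α) ≠ 0 := by
  set W : ℕ → Set UnitAddCircle := fun M => ⋃ n ∈ Ici M, weightArc ψ α n with hW
  have hanti : Antitone W := fun a b hab =>
    biUnion_subset_biUnion_left (Ici_subset_Ici.2 hab)
  have hmeas : ∀ M, MeasurableSet (W M) := fun M =>
    MeasurableSet.biUnion (to_countable _) fun n _ => measurableSet_weightArc ψ α n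
  have hlim := tendsto_measure_iInter_atTop (μ := (volume : Measure UnitAddCircle))
    (fun M => (hmeas M).nullMeasurableSet) hanti ⟨0, measure_ne_top _ _⟩
  have hge : ENNReal.ofReal (1 / 512) ≤ volume (⋂ M, W M) := by
    refine ge_of_tendsto hlim ?_
    filter_upwards [eventually_ge_atTop (q 2)] with M hM
    rw [Function.comp_apply, ← ofReal_measureReal (measure_ne_top _ _)]
    exact ENNReal.ofReal_le_ofReal (h.volume_iUnion_weightArc_ge hψ hpos hsum hM)
  have hsub : ⋂ M, W M ⊆ approxSet ψ α := by
    intro x hx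
    rw [approxSet, mem_ofPred_eq, frequently_atTop]
    intro M
    have := mem_iInter.1 hx M
    simp only [hW, mem_iUnion] at this
    obtain ⟨n, hn, hxn⟩ := this
    refine ⟨n, hn, Metric.closedBall_subset_ball ?_ hxn⟩
    have h1 : approxWeight ψ α n ≤ ψ n := min_le_left _ _
    have := hpos n
    linarith
  intro h0
  have := hge.trans ((measure_mono hsub).trans h0.le)
  norm_num at this

end IsReturnSequence

/-- Zero-one law for approximation by the orbit of an ergodic rotation. -/
theorem approxSet_ae_eq_empty_or_univ (hψ : Antitone ψ) (hα : addOrderOf α = 0) :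
    approxSet ψ α =ᵐ[volume] (∅ : Set UnitAddCircle) ∨ approxSet ψ α =ᵐ[volume] univ := by
  have herg : Ergodic (· + α) (volume : Measure UnitAddCircle) := AddCircle.ergodic_add_right.2 hα
  have hmeas : MeasurableSet (approxSet ψ α) := by
    have : approxSet ψ α = limsup (fun n => Metric.ball (n • α) (ψ n)) atTop := by
      ext x
      rw [mem_limsup_iff_frequently_mem, approxSet, mem_ofPred_eq]
    rw [this]
    exact MeasurableSet.measurableSet_limsup fun n => Metric.isOpen_ball.measurableSet
  -- Translation by `α` lowers the index by one, where the arc is no smaller. One inclusion suffices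
  -- for ergodicity.
  have hsub : (· + α) ⁻¹' approxSet ψ α ⊆ approxSet ψ α := by
    intro x hx
    rw [mem_preimage, approxSet, mem_ofPred_eq, frequently_atTop] at hx
    rw [approxSet, mem_ofPred_eq, frequently_atTop]
    intro M
    obtain ⟨n, hn, hxn⟩ := hx (M + 1)
    obtain ⟨l, rfl⟩ : ∃ l, n = l + 1 := ⟨n - 1, by omega⟩
    refine ⟨l, by omega, ?_⟩
    rw [Metric.mem_ball, succ_nsmul, dist_add_right] at hxn
    exact Metric.mem_ball.2 (hxn.trans_le (hψ (Nat.le_succ l)))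
  exact herg.ae_empty_or_univ_of_preimage_ae_le hmeas.nullMeasurableSet
    (Eventually.of_forall hsub)

/-- If the weights are not summable, almost every point lies in infinitely many arcs. -/
theorem IsReturnSequence.ae_frequently (h : IsReturnSequence α q) (hα : addOrderOf α = 0)
    (hψ : Antitone ψ) (hpos : ∀ n, 0 < ψ n) (hsum : ¬ Summable (approxWeight ψ α)) :
    ∀ᵐ x : UnitAddCircle, x ∈ approxSet ψ α := by
  rcases approxSet_ae_eq_empty_or_univ hψ hα with h0 | h1
  · exact absurd (ae_eq_empty.1 h0) (h.volume_approxSet_ne_zero hψ hpos hsum)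
  · exact eventuallyEq_univ.1 h1

end Divergence
/-! ### Back to the real line -/

/-- Each interval `(t, t + 1]` maps to the circle preserving measure, and countably many of them
cover the line. -/
theorem ae_real_of_ae_unitAddCircle {p : UnitAddCircle → Prop} (hp : ∀ᵐ x, p x) :
    ∀ᵐ s : ℝ, p (s : UnitAddCircle) := by
  have h1 : ∀ t : ℤ, ∀ᵐ s : ℝ ∂(volume.restrict (Ioc (t : ℝ) (t + 1))), p (s : UnitAddCircle) :=
    fun t => (UnitAddCircle.measurePreserving_mk (t : ℝ)).quasiMeasurePreserving.ae hp
  rw [← ae_restrict_iUnion_iff, iUnion_Ioc_intCast, Measure.restrict_univ] at h1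
  exact h1

theorem addOrderOf_coe_eq_zero_of_irrational {θ : ℝ} (hθ : Irrational θ) :
    addOrderOf (θ : UnitAddCircle) = 0 := by
  rw [addOrderOf_eq_zero_iff']
  intro n hn h0
  rw [← AddCircle.coe_nsmul, AddCircle.coe_eq_zero_iff] at h0
  obtain ⟨m, hm⟩ := h0
  have : Irrational ((n : ℝ) * θ) := hθ.natCast_mul hn.ne'
  exact this.ne_int m (by simpa using hm.symm)

theorem IsReturnSequence.tendsto_sum_iff {α : UnitAddCircle} {q : ℕ → ℕ} {ψ : ℕ → ℝ}
    (h : IsReturnSequence α q) (hpos : ∀ n, 0 < ψ n) :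
    Tendsto (fun K => ∑ k ∈ Finset.range K, ∑ n ∈ Finset.Ico (q k) (q (k + 1)),
      min (ψ n) ‖q k • α‖) atTop atTop ↔ ¬ Summable (approxWeight ψ α) := by
  have hg0 : ∀ n, 0 ≤ approxWeight ψ α n := approxWeight_nonneg hpos α
  simp only [h.sum_blocks]
  constructor
  · intro ht hs
    obtain ⟨K, hK⟩ := (ht.eventually_gt_atTop (∑' n, approxWeight ψ α n)).exists
    exact absurd (hs.sum_le_tsum _ fun n _ => hg0 n) (not_le.2 hK)
  · intro hs
    have h1 := ((not_summable_iff_tendsto_nat_atTop_of_nonneg hg0).1 hs).comp h.tendsto_atTop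
    refine (tendsto_atTop_add_const_right _ (-∑ n ∈ Finset.range 1, approxWeight ψ α n) h1).congr
      fun K => ?_
    rw [Finset.sum_Ico_eq_sub _ (h.pos K), Function.comp_apply, sub_eq_add_neg]

theorem mainTheorem1 (ψ : ℕ → ℝ) (hψ_pos : ∀ n : ℕ, 1 ≤ n → 0 < ψ n)
    (hψ_anti : ∀ m n : ℕ, 1 ≤ m → m ≤ n → ψ n ≤ ψ m)
    (θ : ℝ) (hθ : Irrational θ) :
    ∀ᵐ s : ℝ ∂MeasureTheory.volume,
      ({n : ℕ | 1 ≤ n ∧ distNearestInt ((n : ℝ) * θ - s) < ψ n}.Infinite ↔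
        Filter.Tendsto
          (fun K : ℕ => ∑ k ∈ Finset.range K,
            ∑ n ∈ Finset.Ico (convergentDen θ k) (convergentDen θ (k + 1)),
              min (ψ n) (distNearestInt ((convergentDen θ k : ℝ) * θ)))
          Filter.atTop Filter.atTop) := by
  -- Nothing is assumed about `ψ 0`; replacing it by `ψ 1` makes the sequence positive and antitone
  -- on all of `ℕ`.
  set φ : ℕ → ℝ := fun n => ψ (max 1 n) with hφ
  have hφψ : ∀ n, 1 ≤ n → φ n = ψ n := fun n hn => by simp only [hφ, max_eq_right hn]
  have hpos : ∀ n, 0 < φ n := fun n => hψ_pos _ (le_max_left _ _)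
  have hanti : Antitone φ := fun m n hmn =>
    hψ_anti _ _ (le_max_left _ _) (max_le_max le_rfl hmn)
  have h := isReturnSequence_convergentDen hθ
  have hsum : (fun K : ℕ => ∑ k ∈ Finset.range K,
      ∑ n ∈ Finset.Ico (convergentDen θ k) (convergentDen θ (k + 1)),
        min (ψ n) (distNearestInt ((convergentDen θ k : ℝ) * θ))) =
      fun K => ∑ k ∈ Finset.range K, ∑ n ∈ Finset.Ico (convergentDen θ k) (convergentDen θ (k + 1)),
        min (φ n) ‖convergentDen θ k • (θ : UnitAddCircle)‖ := by
    funext K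
    refine Finset.sum_congr rfl fun k _ => Finset.sum_congr rfl fun n hn => ?_
    rw [norm_nsmul_coe_eq, hφψ n ((h.pos k).trans_le (Finset.mem_Ico.1 hn).1)]
  rw [hsum, h.tendsto_sum_iff hpos]
  have hset : ∀ s : ℝ, {n : ℕ | 1 ≤ n ∧ distNearestInt ((n : ℝ) * θ - s) < ψ n}.Infinite ↔
      ∃ᶠ n in atTop, (s : UnitAddCircle) ∈ Metric.ball (n • (θ : UnitAddCircle)) (φ n) := by
    intro s
    rw [← Nat.frequently_atTop_iff_infinite]
    refine frequently_congr ?_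
    filter_upwards [eventually_ge_atTop 1] with n hn
    rw [Metric.mem_ball', dist_eq_norm, ← AddCircle.coe_nsmul, ← AddCircle.coe_sub,
      UnitAddCircle.norm_eq, hφψ n hn, nsmul_eq_mul]
    simp only [hn, true_and, distNearestInt]
  simp only [hset]
  by_cases hs : Summable (approxWeight φ (θ : UnitAddCircle))
  · filter_upwards [ae_real_of_ae_unitAddCircle (h.ae_not_frequently hanti hpos hs)] with s hns
    refine iff_of_false (fun hf => hns (hf.mono fun n hn => ?_)) (not_not.2 hs)
    exact Metric.ball_subset_closedBall hn
  · filter_upwards [ae_real_of_ae_unitAddCircle (h.ae_frequently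
      (addOrderOf_coe_eq_zero_of_irrational hθ) hanti hpos hs)] with s hf
    exact iff_of_true hf hs
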